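/- **Theorem (Almost Strong Convexity of Loss).** *Network.* Let $L\ge 1$ be the number of hidden layers, $d\ge1$ the input dimension and $m$ the width. For $x\in\mathbb R^d$ let $$f(\theta;x)=\tfrac1{\sqrt m}\,v^\top\phi\Big(\tfrac1{\sqrt m}W^{(L)}\phi\big(\cdots\tfrac1{\sqrt m}W^{(2)}\phi\big(\tfrac1{\sqrt d}W^{(1)}x\big)\cdots\big)\Big),$$ where $\phi$ is applied entrywise, $W^{(1)}\in\mathbb R^{m\times d}$, $W^{(2)},\dots,W^{(L)}\in\mathbb R^{m\times m}$, $v\in\mathbb R^m$, and $\theta$ is the vector of all entries of $W^{(1)},\dots,W^{(L)},v$, with the Euclidean norm. The activation $\phi:\mathbb R\to\mathbb R$ is twice differentiable with $|\phi'|$ and $|\phi''|$ bounded. The inputs are those $x$ with $\|x\|_2\le B\sqrt d$, for a fixed $B>0$. *Initialization.* $\theta_0$ has independent entries $W^{(l)}_{ij}\sim\mathcal N(0,1)$ and, independently of them, a random unit vector $v$ (with any law $\nu$ on the unit sphere). Let $B_\rho(\theta_0)=\{\theta:\|\theta-\theta_0\|_2\le\rho\}$. *Claim.* There are constants $C,c,\varrho>0$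 and numbers $0<c_H=c_H(\rho)\le C\max(1,\rho)^{3L}$, all depending only on $L,\phi,B$ (and $c_H$ also on $\rho$), such that for every $\rho>0$ and $d\ge 1$ there is $m_0$ such that for all $m\ge m_0$ and all $\nu$ there is an event of probability at least $1-Ce^{-cm}$ over the initialization $\theta_0$ on which the following hold. 1. For all $\theta\in B_\rho(\theta_0)$ and all inputs $x$: $\ \|\nabla_\theta^2f(\theta;x)\|_2\le c_H/\sqrt m\ $ and $\ \|\nabla_\theta f(\theta;x)\|_2\le\varrho$. 2. Let $z=\{(x_i,y_i)\}_{i=1}^{n}$, $n\ge1$, be any data with inputs $x_i$ as above and $y_i\in\mathbb R$, and let $\mathcal L(\theta;z)=\frac1n\sum_{i=1}^n\ell(y_i,f(\theta;x_i))$, where, for some $\lambda,a>0$, each $\ell_i=\ell(y_i,\cdot)$ is twice differentiable with $|\ell_i'|\le\lambda$ and $\ell_i''\ge a$ at all the predictions $f(\theta;x_i)$, $\theta\in B_\rho(\theta_0)$. Then for all $\theta_t,\theta',\theta''\in B_\rho(\theta_0)$, $$\mathcal L(\theta';z)\ \ge\ \mathcal L(\theta_t;z)+\langle\theta'-\theta_t,\nabla_\theta\mathcal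 L(\theta_t;z)\rangle+\frac12\Big(\frac an\sum_{i=1}^n\langle\theta'-\theta_t,\nabla_\theta f(\theta'';x_i)\rangle^2-\epsilon_t\Big),\qquad \epsilon_t=\frac{4(4a\varrho\rho+\lambda)c_H\rho^2}{\sqrt m}.$$ For a single example ($n=1$) the sum is $a\langle\theta'-\theta_t,\nabla_\theta f(\theta'';x)\rangle^2$. -/

import Mathlib

open MeasureTheory ProbabilityTheory

noncomputable section

namespace OnlineNN

/-- The activation is twice differentiable with bounded first and second derivative. -/
structure SmoothActivation (φ : ℝ → ℝ) : Prop where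
  differentiable : Differentiable ℝ φ
  differentiable_deriv : Differentiable ℝ (deriv φ)
  bounded_deriv : ∃ K : ℝ, ∀ u, |deriv φ u| ≤ K
  bounded_deriv2 : ∃ K : ℝ, ∀ u, |deriv (deriv φ) u| ≤ K

/-- Positions of the hidden weights of a network with input dimension `d`, width `m` and `L ≥ 1`
hidden layers: one `m × d` matrix, followed by `L - 1` matrices of size `m × m`. -/
abbrev WeightIdx (d m L : ℕ) : Type := (Fin m × Fin d) ⊕ (Fin (L - 1) × Fin m × Fin m)

/-- Positions of all parameters: the hidden weights and the output vector. -/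
abbrev ParamIdx (d m L : ℕ) : Type := WeightIdx d m L ⊕ Fin m

/-- The parameter space, with the Euclidean norm of the vector of all the parameters. -/
abbrev Param (d m L : ℕ) : Type := EuclideanSpace ℝ (ParamIdx d m L)

/-- The first weight matrix `W⁽¹⁾`. -/
def firstW {d m L : ℕ} (θ : Param d m L) : Matrix (Fin m) (Fin d) ℝ :=
  fun i j => θ (Sum.inl (Sum.inl (i, j)))

/-- The weight matrices `W⁽²⁾, …, W⁽ᴸ⁾`, indexed from `0`. -/
def hiddenW {d m L : ℕ} (θ : Param d m L) (l : Fin (L - 1)) : Matrix (Fin m) (Fin m) ℝ :=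
  fun i j => θ (Sum.inl (Sum.inr (l, i, j)))

/-- The output vector `v`. -/
def outV {d m L : ℕ} (θ : Param d m L) : Fin m → ℝ := fun i => θ (Sum.inr i)

/-- One layer: `φ (W u / √k)`, with `k` the number of inputs of the layer and `φ` entrywise. -/
def layer (φ : ℝ → ℝ) {m k : ℕ} (W : Matrix (Fin m) (Fin k) ℝ) (u : Fin k → ℝ) : Fin m → ℝ :=
  fun i => φ ((√(k : ℝ))⁻¹ * W.mulVec u i)

/-- A stack of `k` square layers; the matrix with index `0` is applied first. -/
def stack (φ : ℝ → ℝ) {m : ℕ} :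
    (k : ℕ) → (Fin k → Matrix (Fin m) (Fin m) ℝ) → (Fin m → ℝ) → (Fin m → ℝ)
  | 0, _, u => u
  | k + 1, W, u => layer φ (W (Fin.last k)) (stack φ k (fun l => W l.castSucc) u)

/-- The network
`f(θ; x) = m^{-1/2} vᵀ φ(m^{-1/2} W⁽ᴸ⁾ φ(⋯ m^{-1/2} W⁽²⁾ φ(d^{-1/2} W⁽¹⁾ x)⋯))`. -/
def net (φ : ℝ → ℝ) {d m L : ℕ} (θ : Param d m L) (x : EuclideanSpace ℝ (Fin d)) : ℝ :=
  (√(m : ℝ))⁻¹ * (outV θ ⬝ᵥ stack φ (L - 1) (hiddenW θ) (layer φ (firstW θ) x.ofLp))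

/-- The gradient of the network in the parameters. -/
def netGrad (φ : ℝ → ℝ) {d m L : ℕ} (x : EuclideanSpace ℝ (Fin d)) (θ : Param d m L) :
    Param d m L :=
  gradient (fun θ => net φ θ x) θ

/-- The Hessian of the network in the parameters; its operator norm is the spectral norm. -/
def netHess (φ : ℝ → ℝ) {d m L : ℕ} (x : EuclideanSpace ℝ (Fin d)) (θ : Param d m L) :
    Param d m L →L[ℝ] Param d m L :=
  fderiv ℝ (netGrad φ x) θ

/-- The loss `(1/n) ∑ᵢ ℓ(yᵢ, f(θ; xᵢ))` on the data `z = (xᵢ, yᵢ)`, `i = 1, …, n`. -/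
def batchLoss (φ : ℝ → ℝ) (ℓ : ℝ → ℝ → ℝ) {d m L n : ℕ}
    (x : Fin n → EuclideanSpace ℝ (Fin d)) (y : Fin n → ℝ) (θ : Param d m L) : ℝ :=
  (n : ℝ)⁻¹ * ∑ i, ℓ (y i) (net φ θ (x i))

/-- On `S` the function `g` is twice differentiable with `|g'| ≤ lam` and `g'' ≥ a`. -/
def LipschitzStronglyConvexOn (g : ℝ → ℝ) (lam a : ℝ) (S : Set ℝ) : Prop :=
  ∀ u ∈ S, DifferentiableAt ℝ g u ∧ DifferentiableAt ℝ (deriv g) u ∧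
    |deriv g u| ≤ lam ∧ a ≤ deriv (deriv g) u

/-- The parameter vector with hidden weights `w` and output vector `v`. -/
def assemble {d m L : ℕ}
    (p : (WeightIdx d m L → ℝ) × Metric.sphere (0 : EuclideanSpace ℝ (Fin m)) 1) :
    Param d m L :=
  WithLp.toLp 2 (Sum.elim p.1 (p.2 : EuclideanSpace ℝ (Fin m)).ofLp)

/-- The law of the initialization `θ₀`: the hidden weights are independent standard Gaussians, and
the output vector is, independently of them, a random unit vector with law `ν`. -/
def initLaw (d m L : ℕ) (ν : Measure (Metric.sphere (0 : EuclideanSpace ℝ (Fin m)) 1)) :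
    Measure (Param d m L) :=
  ((Measure.pi fun _ : WeightIdx d m L => gaussianReal 0 1).prod ν).map assemble

theorem measurable_assemble (d m L : ℕ) : Measurable (assemble (d := d) (m := m) (L := L)) := by
  unfold assemble
  refine (WithLp.measurable_toLp 2 _).comp (measurable_pi_lambda _ ?_)
  rintro (i | i)
  · exact (measurable_pi_apply i).comp measurable_fst
  · have h : Measurable fun v : EuclideanSpace ℝ (Fin m) => v.ofLp i := by fun_prop
    exact h.comp (measurable_subtype_coe.comp measurable_snd)

instance instIsProbabilityMeasureInitLaw (d m L : ℕ)
    (ν : Measure (Metric.sphere (0 : EuclideanSpace ℝ (Fin m)) 1)) [IsProbabilityMeasure ν] :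
    IsProbabilityMeasure (initLaw d m L ν) :=
  Measure.isProbabilityMeasure_map (measurable_assemble d m L).aemeasurable

end OnlineNN

end

noncomputable section

set_option maxSynthPendingDepth 3

namespace OnlineNN

/-! ### Derivative bounds under linear and bilinear operations -/

section Jets

variable {E V V' : Type*} [NormedAddCommGroup E] [NormedSpace ℝ E]
  [NormedAddCommGroup V] [NormedSpace ℝ V] [NormedAddCommGroup V'] [NormedSpace ℝ V']

/-! In each layer the pre-activation is bilinear in the parameters and the previous layer, through a
bilinear map of norm at most 1, because the Euclidean norm of the entries dominates the operator
norm. If every weight matrix has operator norm at most `R * √m`, the scaling `1/√m` cancels this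
growth. By induction over the layers, the last hidden layer has size `O(√m)` and first and second
derivatives `O(1)` in the parameters (`exists_jetBound_stack`). The readout carries one more factor
`1/√m`, and the output vector stays of norm at most `1 + ρ`. So the gradient is bounded and the
Hessian is `O((1 + ρ)/√m)` (`exists_bound_fderiv_net`).

A Gaussian matrix with both sides at most `m` has norm at most `80 * √m` up to probability `exp
(-m)` (`measure_norm_gaussianOp_le_exp`). Moving by `ρ ≤ √m` raises this to at most `81 * √m`. Hence
the good event does not depend on `ρ`, and `cH` grows only linearly in `ρ`, well within the allowed
power.

For the loss, strong convexity of `ℓ` is applied to the two predictions. Their difference is the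
pairing of `θ' - θt` with a gradient at an intermediate point, which the Hessian bound lets one
replace by the gradient at `θt` or `θ''` (`almost_convex_comp`). Averaging over the data finishes
the proof.

The second derivative of `φ` need not be continuous, so only differentiability of the first
derivative and mean value theorems are used. -/

/-- The map and its derivative are differentiable. -/
structure TwiceDifferentiable (F : E → V) : Prop where
  differentiable : Differentiable ℝ F
  differentiable_fderiv : Differentiable ℝ (fderiv ℝ F)

/-- Bounds on the value and on the first two derivatives of a map at a point. -/
structure JetBound (F : E → V) (θ : E) (b₀ b₁ b₂ : ℝ) : Prop where
  norm_le : ‖F θ‖ ≤ b₀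
  norm_fderiv_le : ‖fderiv ℝ F θ‖ ≤ b₁
  norm_fderiv2_le : ‖fderiv ℝ (fderiv ℝ F) θ‖ ≤ b₂

theorem norm_precompR_apply_le {W : Type*} [NormedAddCommGroup W] [NormedSpace ℝ W]
    (T : W →L[ℝ] V →L[ℝ] V') (w : W) : ‖T.precompR E w‖ ≤ ‖T w‖ := by
  refine ContinuousLinearMap.opNorm_le_bound _ (norm_nonneg _) fun A => ?_
  exact ContinuousLinearMap.opNorm_comp_le (T w) A

/-- The derivative of a bilinear expression. -/
theorem hasFDerivAt_bilinear {W : Type*} [NormedAddCommGroup W] [NormedSpace ℝ W]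
    (T : W →L[ℝ] V →L[ℝ] V') {p : E → W} {u : E → V} {p' : E →L[ℝ] W} {u' : E →L[ℝ] V} {θ : E}
    (hp : HasFDerivAt p p' θ) (hu : HasFDerivAt u u' θ) :
    HasFDerivAt (fun η => T (p η) (u η)) (T.precompR E (p θ) u' + (T.flip (u θ)).comp p') θ := by
  exact T.hasFDerivAt_of_bilinear hp hu

/-- The first term keeps `‖T (p θ)‖` instead of `‖T‖ * ‖p θ‖`. For weights this is the operator
norm, of order `√m`, and not the Euclidean norm of all entries, which would ruin the bounds. -/
theorem norm_fderiv_bilinear_le {W : Type*} [NormedAddCommGroup W] [NormedSpace ℝ W]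
    (T : W →L[ℝ] V →L[ℝ] V') {p : E → W} {u : E → V} {θ : E}
    (hp : DifferentiableAt ℝ p θ) (hu : DifferentiableAt ℝ u θ) :
    ‖fderiv ℝ (fun η => T (p η) (u η)) θ‖ ≤
      ‖T (p θ)‖ * ‖fderiv ℝ u θ‖ + ‖T‖ * ‖u θ‖ * ‖fderiv ℝ p θ‖ := by
  rw [(hasFDerivAt_bilinear T hp.hasFDerivAt hu.hasFDerivAt).fderiv]
  refine (norm_add_le _ _).trans (add_le_add ?_ ?_)
  · exact ContinuousLinearMap.opNorm_comp_le _ _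
  · refine (ContinuousLinearMap.opNorm_comp_le _ _).trans ?_
    gcongr
    simpa using T.flip.le_opNorm (u θ)

theorem fderiv_apply_bilinear (T : E →L[ℝ] V →L[ℝ] V') {u : E → V} (hu : Differentiable ℝ u) :
    fderiv ℝ (fun θ => T θ (u θ)) = fun θ => T.precompR E θ (fderiv ℝ u θ) + T.flip (u θ) := by
  funext θ
  exact (hasFDerivAt_bilinear T (p := fun η => η) (hasFDerivAt_id θ) (hu θ).hasFDerivAt).fderiv

theorem TwiceDifferentiable.bilinear (T : E →L[ℝ] V →L[ℝ] V') {u : E → V}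
    (hu : TwiceDifferentiable u) : TwiceDifferentiable fun θ => T θ (u θ) := by
  have h1 := hu.differentiable
  have h2 := hu.differentiable_fderiv
  refine ⟨by fun_prop, ?_⟩
  rw [fderiv_apply_bilinear T h1]
  fun_prop

/-- The first factor is `θ` itself, with derivative the identity and no second derivative. The
product rule therefore leaves only one extra `b₀`, and two cross terms `b₁` at second order. -/
theorem JetBound.bilinear (T : E →L[ℝ] V →L[ℝ] V') (hT : ‖T‖ ≤ 1) {u : E → V}
    (hu : TwiceDifferentiable u) {θ : E} {a b₀ b₁ b₂ : ℝ} (ha : ‖T θ‖ ≤ a)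
    (h : JetBound u θ b₀ b₁ b₂) :
    JetBound (fun θ => T θ (u θ)) θ (a * b₀) (a * b₁ + b₀) (a * b₂ + 2 * b₁) := by
  have ha0 : 0 ≤ a := (norm_nonneg _).trans ha
  have h1 := hu.differentiable
  have h2 := hu.differentiable_fderiv
  obtain ⟨k0, k1, k2⟩ := h
  have hb0 : 0 ≤ b₀ := (norm_nonneg _).trans k0
  have hb1 : 0 ≤ b₁ := (norm_nonneg _).trans k1
  have hid : ‖fderiv ℝ (fun η : E => η) θ‖ ≤ 1 := by
    rw [fderiv_fun_id]; exact ContinuousLinearMap.norm_id_le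
  have hflip : ‖T.flip‖ ≤ 1 := by simpa using hT
  refine ⟨?_, ?_, ?_⟩
  · exact ((T θ).le_opNorm _).trans (by gcongr)
  · refine (norm_fderiv_bilinear_le T (p := fun η => η) differentiableAt_id (h1 θ)).trans ?_
    have e1 : ‖T‖ * ‖u θ‖ * ‖fderiv ℝ (fun η : E => η) θ‖ ≤ 1 * b₀ * 1 := by gcongr
    have e2 : ‖T θ‖ * ‖fderiv ℝ u θ‖ ≤ a * b₁ := by gcongr
    linarith
  · rw [fderiv_apply_bilinear T h1]
    have d1 : DifferentiableAt ℝ (fun θ => T.precompR E θ (fderiv ℝ u θ)) θ := by fun_prop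
    have d2 : DifferentiableAt ℝ (fun θ => T.flip (u θ)) θ := by fun_prop
    rw [fderiv_fun_add d1 d2]
    have e1 := norm_fderiv_bilinear_le (T.precompR E) (p := fun η => η) differentiableAt_id (h2 θ)
    have e2 : fderiv ℝ (fun θ => T.flip (u θ)) θ = T.flip.comp (fderiv ℝ u θ) :=
      (T.flip.hasFDerivAt.comp θ (h1 θ).hasFDerivAt).fderiv
    have e3 : ‖T.precompR E‖ ≤ 1 := (T.norm_precompR_le E).trans hT
    have e4 : ‖T.precompR E‖ * ‖fderiv ℝ u θ‖ * ‖fderiv ℝ (fun η : E => η) θ‖ ≤ 1 * b₁ * 1 := by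
      gcongr
    have e5 : ‖T.precompR E θ‖ * ‖fderiv ℝ (fderiv ℝ u) θ‖ ≤ a * b₂ := by
      gcongr
      exact (norm_precompR_apply_le T θ).trans ha
    have e6 : ‖T.flip.comp (fderiv ℝ u θ)‖ ≤ 1 * b₁ :=
      (ContinuousLinearMap.opNorm_comp_le _ _).trans (by gcongr)
    rw [e2]
    refine (norm_add_le _ _).trans ?_
    linarith

theorem TwiceDifferentiable.const_smul (s : ℝ) {u : E → V} (hu : TwiceDifferentiable u) :
    TwiceDifferentiable fun θ => s • u θ := by
  have h1 := hu.differentiable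
  have h2 := hu.differentiable_fderiv
  refine ⟨by fun_prop, ?_⟩
  have : fderiv ℝ (fun θ => s • u θ) = fun θ => s • fderiv ℝ u θ := by
    funext θ; exact fderiv_fun_const_smul (h1 θ) s
  rw [this]; fun_prop

theorem JetBound.const_smul {s : ℝ} (hs : 0 ≤ s) {u : E → V} (hu : TwiceDifferentiable u) {θ : E}
    {b₀ b₁ b₂ : ℝ} (h : JetBound u θ b₀ b₁ b₂) :
    JetBound (fun θ => s • u θ) θ (s * b₀) (s * b₁) (s * b₂) := by
  have h1 := hu.differentiable
  have h2 := hu.differentiable_fderiv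
  obtain ⟨k0, k1, k2⟩ := h
  have e : fderiv ℝ (fun θ => s • u θ) = fun θ => s • fderiv ℝ u θ := by
    funext θ; exact fderiv_fun_const_smul (h1 θ) s
  refine ⟨?_, ?_, ?_⟩
  · rw [norm_smul, Real.norm_of_nonneg hs]; gcongr
  · rw [e, norm_smul, Real.norm_of_nonneg hs]; gcongr
  · rw [e, fderiv_fun_const_smul (h2 θ) s, norm_smul, Real.norm_of_nonneg hs]; gcongr

theorem TwiceDifferentiable.const (v : V) : TwiceDifferentiable fun _ : E => v :=
  ⟨by fun_prop, by simp⟩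

theorem JetBound.const (v : V) (θ : E) : JetBound (fun _ : E => v) θ ‖v‖ 0 0 :=
  ⟨le_rfl, by simp, by simp⟩

end Jets

/-! ### Entrywise application of the activation -/

section Activation

variable {n : Type*} [Fintype n] {E : Type*} [NormedAddCommGroup E] [NormedSpace ℝ E]

/-- Application of a scalar function to each coordinate. -/
def entrywise (ψ : ℝ → ℝ) (y : EuclideanSpace ℝ n) : EuclideanSpace ℝ n :=
  WithLp.toLp 2 fun i => ψ (y i)

theorem norm_le_mul_of_abs_le {x y : EuclideanSpace ℝ n} {K : ℝ} (hK : 0 ≤ K)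
    (h : ∀ i, |x i| ≤ K * |y i|) : ‖x‖ ≤ K * ‖y‖ := by
  refine le_of_sq_le_sq ?_ (by positivity)
  rw [mul_pow, EuclideanSpace.norm_sq_eq, EuclideanSpace.norm_sq_eq, Finset.mul_sum]
  refine Finset.sum_le_sum fun i _ => ?_
  rw [← mul_pow]
  exact pow_le_pow_left₀ (abs_nonneg _) (h i) 2

/-- The coordinatewise product as a bilinear map. -/
def hadamard : EuclideanSpace ℝ n →L[ℝ] EuclideanSpace ℝ n →L[ℝ] EuclideanSpace ℝ n :=
  LinearMap.mkContinuous₂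
    (LinearMap.mk₂ ℝ (fun p q => WithLp.toLp 2 fun i => p i * q i)
      (fun p p' q => by ext i; simp [add_mul]) (fun c p q => by ext i; simp [mul_assoc])
      (fun p q q' => by ext i; simp [mul_add]) (fun c p q => by ext i; simp [mul_left_comm]))
    1 (fun p q => by
      rw [one_mul]
      refine norm_le_mul_of_abs_le (norm_nonneg _) fun i => ?_
      simp only [LinearMap.mk₂_apply, abs_mul]
      gcongr
      simpa using PiLp.norm_apply_le p i)

@[simp] theorem hadamard_apply (p q : EuclideanSpace ℝ n) (i : n) :
    hadamard p q i = p i * q i := rfl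

theorem norm_hadamard_le : ‖hadamard (n := n)‖ ≤ 1 :=
  LinearMap.mkContinuous₂_norm_le _ zero_le_one _

theorem norm_hadamard_entrywise_le {ψ : ℝ → ℝ} {K : ℝ} (hK : ∀ u, |ψ u| ≤ K)
    (y : EuclideanSpace ℝ n) : ‖hadamard (entrywise ψ y)‖ ≤ K := by
  have hK0 : 0 ≤ K := (abs_nonneg _).trans (hK 0)
  refine ContinuousLinearMap.opNorm_le_bound _ hK0 fun q => norm_le_mul_of_abs_le hK0 fun i => ?_
  rw [hadamard_apply, abs_mul]
  gcongr
  exact hK _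

theorem hasFDerivAt_entrywise {ψ : ℝ → ℝ} (hψ : Differentiable ℝ ψ)
    {G : E → EuclideanSpace ℝ n} {G' : E →L[ℝ] EuclideanSpace ℝ n} {θ : E}
    (hG : HasFDerivAt G G' θ) :
    HasFDerivAt (fun η => entrywise ψ (G η)) ((hadamard (entrywise (deriv ψ) (G θ))).comp G') θ := by
  rw [← hasFDerivWithinAt_univ, hasFDerivWithinAt_euclidean]
  intro i
  have h1 : HasFDerivAt (fun η => G η i) ((EuclideanSpace.proj i).comp G') θ :=
    (EuclideanSpace.proj i : EuclideanSpace ℝ n →L[ℝ] ℝ).hasFDerivAt.comp θ hG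
  have h2 := (hψ (G θ i)).hasDerivAt.comp_hasFDerivAt θ h1
  rw [hasFDerivWithinAt_univ]
  exact h2

theorem norm_entrywise_le {φ : ℝ → ℝ} (hφ : Differentiable ℝ φ) {K : ℝ}
    (hK : ∀ u, |deriv φ u| ≤ K) (y : EuclideanSpace ℝ n) :
    ‖entrywise φ y‖ ≤ |φ 0| * √(Fintype.card n) + K * ‖y‖ := by
  have hK0 : 0 ≤ K := (abs_nonneg _).trans (hK 0)
  have h0 : ‖(WithLp.toLp 2 fun _ => φ 0 : EuclideanSpace ℝ n)‖ = |φ 0| * √(Fintype.card n) := by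
    rw [EuclideanSpace.norm_eq]
    simp [Real.sqrt_sq_eq_abs, mul_comm]
  have h1 : ‖entrywise φ y - WithLp.toLp 2 fun _ => φ 0‖ ≤ K * ‖y‖ := by
    refine norm_le_mul_of_abs_le hK0 fun i => ?_
    have := convex_univ.norm_image_sub_le_of_norm_deriv_le (f := φ) (C := K) (x := 0) (y := y i)
      (fun x _ => hφ x) (fun x _ => hK x) trivial trivial
    simpa [entrywise] using this
  calc ‖entrywise φ y‖
      = ‖(WithLp.toLp 2 fun _ => φ 0) + (entrywise φ y - WithLp.toLp 2 fun _ => φ 0)‖ := by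
        rw [add_sub_cancel]
    _ ≤ _ := (norm_add_le _ _).trans (by rw [h0]; gcongr)

theorem fderiv_entrywise {φ : ℝ → ℝ} (hφ : Differentiable ℝ φ) {G : E → EuclideanSpace ℝ n}
    (hG : Differentiable ℝ G) :
    fderiv ℝ (fun η => entrywise φ (G η)) = fun η =>
      hadamard.precompR E (entrywise (deriv φ) (G η)) (fderiv ℝ G η) := by
  funext θ
  exact (hasFDerivAt_entrywise hφ (hG θ).hasFDerivAt).fderiv

theorem TwiceDifferentiable.entrywise {φ : ℝ → ℝ} (hφ : SmoothActivation φ)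
    {G : E → EuclideanSpace ℝ n} (hG : TwiceDifferentiable G) :
    TwiceDifferentiable fun η => entrywise φ (G η) := by
  have h1 := hG.differentiable
  have h2 := hG.differentiable_fderiv
  have h3 : Differentiable ℝ fun η => OnlineNN.entrywise (deriv φ) (G η) := fun θ =>
    (hasFDerivAt_entrywise hφ.differentiable_deriv (h1 θ).hasFDerivAt).differentiableAt
  refine ⟨fun θ => (hasFDerivAt_entrywise hφ.differentiable
    (h1 θ).hasFDerivAt).differentiableAt, ?_⟩
  rw [fderiv_entrywise hφ.differentiable h1]
  fun_prop

/-- The derivative is the Hadamard product of `φ'(G)` with `G'`. Multiplication by a vector with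
entries bounded by `K` has norm at most `K`, and the Euclidean norm is submultiplicative for
Hadamard products, so no dimension factor enters the derivative bounds. -/
theorem JetBound.entrywise {φ : ℝ → ℝ} (hφ : SmoothActivation φ) {K : ℝ}
    (hK₁ : ∀ u, |deriv φ u| ≤ K) (hK₂ : ∀ u, |deriv (deriv φ) u| ≤ K)
    {G : E → EuclideanSpace ℝ n} (hG : TwiceDifferentiable G) {θ : E} {b₀ b₁ b₂ : ℝ}
    (h : JetBound G θ b₀ b₁ b₂) :
    JetBound (fun η => entrywise φ (G η)) θ (|φ 0| * √(Fintype.card n) + K * b₀) (K * b₁)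
      (K * b₂ + K * b₁ ^ 2) := by
  have hK0 : 0 ≤ K := (abs_nonneg _).trans (hK₁ 0)
  have h1 := hG.differentiable
  have h2 := hG.differentiable_fderiv
  obtain ⟨k0, k1, k2⟩ := h
  have hb1 : 0 ≤ b₁ := (norm_nonneg _).trans k1
  refine ⟨?_, ?_, ?_⟩
  · exact (norm_entrywise_le hφ.differentiable hK₁ _).trans (by gcongr)
  · rw [fderiv_entrywise hφ.differentiable h1]
    refine (ContinuousLinearMap.opNorm_comp_le _ _).trans ?_
    gcongr
    exact norm_hadamard_entrywise_le hK₁ _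
  · rw [fderiv_entrywise hφ.differentiable h1]
    have h3 := hasFDerivAt_entrywise hφ.differentiable_deriv (h1 θ).hasFDerivAt
    have e0 := norm_fderiv_bilinear_le (V' := E →L[ℝ] EuclideanSpace ℝ n)
      ((hadamard (n := n)).precompR E) h3.differentiableAt (h2 θ)
    rw [h3.fderiv] at e0
    have e1 : ‖hadamard.precompR E (OnlineNN.entrywise (deriv φ) (G θ))‖ ≤ K :=
      (norm_precompR_apply_le (hadamard (n := n)) _).trans (norm_hadamard_entrywise_le hK₁ _)
    have e2 : ‖(hadamard (n := n)).precompR E‖ ≤ 1 :=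
      (ContinuousLinearMap.norm_precompR_le E (hadamard (n := n))).trans norm_hadamard_le
    have e3 : ‖(hadamard (OnlineNN.entrywise (deriv (deriv φ)) (G θ))).comp (fderiv ℝ G θ)‖
        ≤ K * b₁ := by
      refine (ContinuousLinearMap.opNorm_comp_le _ _).trans ?_
      gcongr
      exact norm_hadamard_entrywise_le hK₂ _
    refine e0.trans ?_
    have e4 := mul_le_mul e1 k2 (norm_nonneg _) hK0
    have e5 := mul_le_mul (mul_le_mul e2 k1 (norm_nonneg _) zero_le_one) e3 (norm_nonneg _)
      (by positivity)
    linarith [e4, e5, show 1 * b₁ * (K * b₁) = K * b₁ ^ 2 by ring]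

end Activation

/-! ### Weight matrices and readout as bilinear maps of norm at most 1 -/

section Weights

variable {α β ι : Type*} [Fintype α] [Fintype β] [Fintype ι]

theorem sum_sq_comp_le (g : α ↪ ι) (θ : EuclideanSpace ℝ ι) :
    ∑ p, θ (g p) ^ 2 ≤ ‖θ‖ ^ 2 := by
  classical
  rw [EuclideanSpace.norm_sq_eq]
  simp only [Real.norm_eq_abs, sq_abs]
  rw [← Finset.sum_map Finset.univ g fun i => θ i ^ 2]
  exact Finset.sum_le_sum_of_subset_of_nonneg (Finset.subset_univ _) fun i _ _ => sq_nonneg _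

/-- The action on vectors of the matrix whose entries are the parameters at the positions `g`. -/
def weightOp (g : α × β ↪ ι) :
    EuclideanSpace ℝ ι →L[ℝ] EuclideanSpace ℝ β →L[ℝ] EuclideanSpace ℝ α :=
  LinearMap.mkContinuous₂
    (LinearMap.mk₂ ℝ (fun θ u => WithLp.toLp 2 fun i => ∑ j, θ (g (i, j)) * u j)
      (fun p p' q => by ext i; simp [add_mul, Finset.sum_add_distrib])
      (fun c p q => by ext i; simp [mul_assoc, Finset.mul_sum])
      (fun p q q' => by ext i; simp [mul_add, Finset.sum_add_distrib])
      (fun c p q => by ext i; simp [mul_left_comm, Finset.mul_sum]))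
    1 (fun θ u => by
      rw [one_mul]
      refine le_of_sq_le_sq ?_ (by positivity)
      rw [mul_pow, EuclideanSpace.norm_sq_eq]
      calc ∑ i, ‖∑ j, θ (g (i, j)) * u j‖ ^ 2
          ≤ ∑ i, (∑ j, θ (g (i, j)) ^ 2) * ‖u‖ ^ 2 := by
            refine Finset.sum_le_sum fun i _ => ?_
            rw [EuclideanSpace.norm_sq_eq]
            simpa using Finset.sum_mul_sq_le_sq_mul_sq Finset.univ (fun j => θ (g (i, j))) u
        _ = (∑ p, θ (g p) ^ 2) * ‖u‖ ^ 2 := by rw [← Finset.sum_mul, Fintype.sum_prod_type]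
        _ ≤ _ := by gcongr; exact sum_sq_comp_le g θ)

@[simp] theorem weightOp_apply (g : α × β ↪ ι) (θ : EuclideanSpace ℝ ι) (u : EuclideanSpace ℝ β)
    (i : α) : weightOp g θ u i = ∑ j, θ (g (i, j)) * u j := rfl

theorem norm_weightOp_le (g : α × β ↪ ι) : ‖weightOp g‖ ≤ 1 :=
  LinearMap.mkContinuous₂_norm_le _ zero_le_one _

/-- The pairing of a vector with the parameters at the positions `g`. -/
def readout (g : β ↪ ι) : EuclideanSpace ℝ ι →L[ℝ] EuclideanSpace ℝ β →L[ℝ] ℝ :=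
  LinearMap.mkContinuous₂
    (LinearMap.mk₂ ℝ (fun θ u => ∑ j, θ (g j) * u j)
      (fun p p' q => by simp [add_mul, Finset.sum_add_distrib])
      (fun c p q => by simp [mul_assoc, Finset.mul_sum])
      (fun p q q' => by simp [mul_add, Finset.sum_add_distrib])
      (fun c p q => by simp [mul_left_comm, Finset.mul_sum]))
    1 (fun θ u => by
      rw [one_mul]
      refine le_of_sq_le_sq ?_ (by positivity)
      rw [mul_pow]
      calc ‖∑ j, θ (g j) * u j‖ ^ 2 ≤ (∑ j, θ (g j) ^ 2) * ‖u‖ ^ 2 := by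
            rw [EuclideanSpace.norm_sq_eq]
            simpa using Finset.sum_mul_sq_le_sq_mul_sq Finset.univ (fun j => θ (g j)) u
        _ ≤ _ := by gcongr; exact sum_sq_comp_le g θ)

theorem norm_readout_le (g : β ↪ ι) : ‖readout g‖ ≤ 1 :=
  LinearMap.mkContinuous₂_norm_le _ zero_le_one _

end Weights

/-! ### Width-independent derivative bounds for the network -/

section Network

theorem JetBound.mono {E V : Type*} [NormedAddCommGroup E] [NormedSpace ℝ E]
    [NormedAddCommGroup V] [NormedSpace ℝ V] {F : E → V} {θ : E} {b₀ b₁ b₂ c₀ c₁ c₂ : ℝ}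
    (h : JetBound F θ b₀ b₁ b₂) (h₀ : b₀ ≤ c₀) (h₁ : b₁ ≤ c₁) (h₂ : b₂ ≤ c₂) :
    JetBound F θ c₀ c₁ c₂ :=
  ⟨h.norm_le.trans h₀, h.norm_fderiv_le.trans h₁, h.norm_fderiv2_le.trans h₂⟩

variable {ι : Type*} [Fintype ι] {φ : ℝ → ℝ}

theorem TwiceDifferentiable.layer (hφ : SmoothActivation φ) {m k : ℕ} (g : Fin m × Fin k ↪ ι)
    {u : EuclideanSpace ℝ ι → EuclideanSpace ℝ (Fin k)} (hu : TwiceDifferentiable u) (s : ℝ) :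
    TwiceDifferentiable fun θ => OnlineNN.entrywise φ (s • weightOp g θ (u θ)) :=
  ((hu.bilinear (weightOp g)).const_smul s).entrywise hφ

theorem JetBound.layer (hφ : SmoothActivation φ) {K : ℝ} (hK₁ : ∀ u, |deriv φ u| ≤ K)
    (hK₂ : ∀ u, |deriv (deriv φ) u| ≤ K) {m k : ℕ} (g : Fin m × Fin k ↪ ι)
    {u : EuclideanSpace ℝ ι → EuclideanSpace ℝ (Fin k)} (hu : TwiceDifferentiable u)
    {s : ℝ} (hs : 0 ≤ s) {θ : EuclideanSpace ℝ ι} {a b₀ b₁ b₂ : ℝ} (ha : ‖weightOp g θ‖ ≤ a)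
    (h : JetBound u θ b₀ b₁ b₂) :
    JetBound (fun θ => OnlineNN.entrywise φ (s • weightOp g θ (u θ))) θ
      (|φ 0| * √(m : ℝ) + K * (s * (a * b₀))) (K * (s * (a * b₁ + b₀)))
      (K * (s * (a * b₂ + 2 * b₁)) + K * (s * (a * b₁ + b₀)) ^ 2) := by
  have := ((h.bilinear (weightOp g) (norm_weightOp_le g) hu ha).const_smul hs
    (hu.bilinear (weightOp g))).entrywise hφ hK₁ hK₂ ((hu.bilinear (weightOp g)).const_smul s)
  simpa using this

theorem TwiceDifferentiable.stack (hφ : SmoothActivation φ) {m : ℕ}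
    {u : EuclideanSpace ℝ ι → EuclideanSpace ℝ (Fin m)} (hu : TwiceDifferentiable u) :
    ∀ (k : ℕ) (g : Fin k → (Fin m × Fin m ↪ ι)), TwiceDifferentiable fun θ =>
      (WithLp.toLp 2 (stack φ k (fun l i j => θ (g l (i, j))) (u θ).ofLp) :
        EuclideanSpace ℝ (Fin m))
  | 0, _ => hu
  | k + 1, g => (TwiceDifferentiable.stack hφ hu k fun l => g l.castSucc).layer hφ (g (Fin.last k))
      (√(m : ℝ))⁻¹

/-- Bounds on the output of a stack of layers that do not depend on the width. -/
theorem exists_jetBound_stack (hφ : SmoothActivation φ) {R : ℝ} (hR : 0 ≤ R) (k : ℕ)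
    {α β γ : ℝ} (hα : 0 ≤ α) (hβ : 0 ≤ β) (hγ : 0 ≤ γ) :
    ∃ α' β' γ' : ℝ, 0 ≤ α' ∧ 0 ≤ β' ∧ 0 ≤ γ' ∧
      ∀ {ι : Type} [Fintype ι] {m : ℕ}, 1 ≤ m → ∀ (g : Fin k → (Fin m × Fin m ↪ ι))
        {u : EuclideanSpace ℝ ι → EuclideanSpace ℝ (Fin m)}, TwiceDifferentiable u →
        ∀ θ, JetBound u θ (α * √(m : ℝ)) β γ → (∀ l, ‖weightOp (g l) θ‖ ≤ R * √(m : ℝ)) →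
          JetBound (fun θ => (WithLp.toLp 2 (stack φ k (fun l i j => θ (g l (i, j))) (u θ).ofLp) :
            EuclideanSpace ℝ (Fin m))) θ (α' * √(m : ℝ)) β' γ' := by
  obtain ⟨K₁, hK₁⟩ := hφ.bounded_deriv
  obtain ⟨K₂, hK₂⟩ := hφ.bounded_deriv2
  have hL₁ : ∀ u, |deriv φ u| ≤ max K₁ K₂ := fun u => (hK₁ u).trans (le_max_left _ _)
  have hL₂ : ∀ u, |deriv (deriv φ) u| ≤ max K₁ K₂ := fun u => (hK₂ u).trans (le_max_right _ _)
  set K := max K₁ K₂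
  have hK : 0 ≤ K := (abs_nonneg _).trans (hL₁ 0)
  induction k with
  | zero => exact ⟨α, β, γ, hα, hβ, hγ, fun _ _ _ _ _ h _ => h⟩
  | succ k ih =>
    obtain ⟨α', β', γ', hα', hβ', hγ', ih⟩ := ih
    -- These are the constants of `JetBound.layer` with `s = 1/√m`, `a = R * √m` and `b₀ = α' * √m`,
    -- after the powers of `√m` cancel. Only the term `2 * β'` keeps a factor `1/√m`, which is
    -- dropped.
    refine ⟨|φ 0| + K * (R * α'), K * (R * β' + α'),
      K * (R * γ' + 2 * β') + K * (R * β' + α') ^ 2, by positivity, by positivity, by positivity,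
      fun {ι} _ {m} hm g u hu θ hθ hg => ?_⟩
    have h1 := ih hm (fun l => g l.castSucc) hu θ hθ fun l => hg _
    have hm1 : 1 ≤ √(m : ℝ) := Real.one_le_sqrt.2 (by exact_mod_cast hm)
    have hm0 : √(m : ℝ) ≠ 0 := by positivity
    have hs0 : 0 ≤ (√(m : ℝ))⁻¹ := by positivity
    have hs1 : (√(m : ℝ))⁻¹ ≤ 1 := inv_le_one_of_one_le₀ hm1
    have h2 := h1.layer hφ hL₁ hL₂ (g (Fin.last k))
      (TwiceDifferentiable.stack hφ hu k fun l => g l.castSucc) hs0 (hg (Fin.last k))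
    have e1 : (√(m : ℝ))⁻¹ * (R * √(m : ℝ) * β' + α' * √(m : ℝ)) = R * β' + α' := by
      field_simp
    have e2 : (√(m : ℝ))⁻¹ * (R * √(m : ℝ) * (α' * √(m : ℝ))) = R * α' * √(m : ℝ) := by
      field_simp
    have e3 : (√(m : ℝ))⁻¹ * (R * √(m : ℝ) * γ' + 2 * β') ≤ R * γ' + 2 * β' := by
      have : (√(m : ℝ))⁻¹ * (R * √(m : ℝ) * γ' + 2 * β') =
        R * γ' + (√(m : ℝ))⁻¹ * (2 * β') := by field_simp
      rw [this]
      have := mul_le_mul_of_nonneg_right hs1 (show 0 ≤ 2 * β' by positivity)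
      linarith
    rw [e1, e2] at h2
    refine h2.mono (by linarith) le_rfl ?_
    gcongr

variable {d m L : ℕ}

/-- The positions of the first weight matrix. -/
def firstIdx (d m L : ℕ) : Fin m × Fin d ↪ WeightIdx d m L := Function.Embedding.inl

/-- The positions of the square weight matrices. -/
def hiddenIdx (d m L : ℕ) (l : Fin (L - 1)) : Fin m × Fin m ↪ WeightIdx d m L :=
  ⟨fun p => Sum.inr (l, p), fun p q h => by simpa using h⟩

/-- The first weight matrix as an operator, depending linearly on the parameters. -/
def firstOp (d m L : ℕ) :
    Param d m L →L[ℝ] EuclideanSpace ℝ (Fin d) →L[ℝ] EuclideanSpace ℝ (Fin m) :=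
  weightOp ((firstIdx d m L).trans Function.Embedding.inl)

/-- The square weight matrices as operators, depending linearly on the parameters. -/
def hiddenOp (d m L : ℕ) (l : Fin (L - 1)) :
    Param d m L →L[ℝ] EuclideanSpace ℝ (Fin m) →L[ℝ] EuclideanSpace ℝ (Fin m) :=
  weightOp ((hiddenIdx d m L l).trans Function.Embedding.inl)

/-- The output vector as a functional, depending linearly on the parameters. -/
def outOp (d m L : ℕ) : Param d m L →L[ℝ] EuclideanSpace ℝ (Fin m) →L[ℝ] ℝ :=
  readout Function.Embedding.inr

/-- The output of the last hidden layer. -/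
def features (φ : ℝ → ℝ) (x : EuclideanSpace ℝ (Fin d)) (θ : Param d m L) :
    EuclideanSpace ℝ (Fin m) :=
  WithLp.toLp 2 (stack φ (L - 1) (hiddenW θ) (layer φ (firstW θ) x.ofLp))

theorem net_eq (x : EuclideanSpace ℝ (Fin d)) :
    (fun θ : Param d m L => net φ θ x) =
      fun θ => (√(m : ℝ))⁻¹ • outOp d m L θ (features φ x θ) := rfl

theorem twiceDifferentiable_features (hφ : SmoothActivation φ) (x : EuclideanSpace ℝ (Fin d)) :
    TwiceDifferentiable (features φ x : Param d m L → _) :=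
  TwiceDifferentiable.stack hφ ((TwiceDifferentiable.const x).layer hφ
    ((firstIdx d m L).trans Function.Embedding.inl) (√(d : ℝ))⁻¹) (L - 1)
    fun l => (hiddenIdx d m L l).trans Function.Embedding.inl

theorem twiceDifferentiable_net (hφ : SmoothActivation φ) (x : EuclideanSpace ℝ (Fin d)) :
    TwiceDifferentiable fun θ : Param d m L => net φ θ x := by
  rw [net_eq]
  exact ((twiceDifferentiable_features hφ x).bilinear (outOp d m L)).const_smul _

theorem exists_jetBound_features (hφ : SmoothActivation φ) {R B : ℝ} (hR : 0 ≤ R) (hB : 0 ≤ B)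
    (L : ℕ) :
    ∃ α β γ : ℝ, 0 ≤ α ∧ 0 ≤ β ∧ 0 ≤ γ ∧ ∀ {d m : ℕ}, 1 ≤ d → 1 ≤ m →
      ∀ θ : Param d m L, ‖firstOp d m L θ‖ ≤ R * √(m : ℝ) →
        (∀ l, ‖hiddenOp d m L l θ‖ ≤ R * √(m : ℝ)) →
        ∀ x : EuclideanSpace ℝ (Fin d), ‖x‖ ≤ B * √(d : ℝ) →
          JetBound (features φ x) θ (α * √(m : ℝ)) β γ := by
  obtain ⟨K₁, hK₁⟩ := hφ.bounded_deriv
  obtain ⟨K₂, hK₂⟩ := hφ.bounded_deriv2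
  have hL₁ : ∀ u, |deriv φ u| ≤ max K₁ K₂ := fun u => (hK₁ u).trans (le_max_left _ _)
  have hL₂ : ∀ u, |deriv (deriv φ) u| ≤ max K₁ K₂ := fun u => (hK₂ u).trans (le_max_right _ _)
  set K := max K₁ K₂
  have hK : 0 ≤ K := (abs_nonneg _).trans (hL₁ 0)
  -- The first layer has a constant input, so only the derivative of its weights counts, and `‖x‖ /
  -- √d ≤ B`.
  obtain ⟨α, β, γ, hα, hβ, hγ, h⟩ := exists_jetBound_stack hφ hR (L - 1)
    (α := |φ 0| + K * (R * B)) (β := K * B) (γ := K * B ^ 2)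
    (by positivity) (by positivity) (by positivity)
  refine ⟨α, β, γ, hα, hβ, hγ, fun {d m} hd hm θ h₁ h₂ x hx => ?_⟩
  refine h hm (fun l => (hiddenIdx d m L l).trans Function.Embedding.inl)
    ((TwiceDifferentiable.const x).layer hφ ((firstIdx d m L).trans Function.Embedding.inl)
      (√(d : ℝ))⁻¹) θ ?_ h₂
  have hd1 : 1 ≤ √(d : ℝ) := Real.one_le_sqrt.2 (by exact_mod_cast hd)
  have hs0 : 0 ≤ (√(d : ℝ))⁻¹ := by positivity
  have hsx : (√(d : ℝ))⁻¹ * ‖x‖ ≤ B := by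
    rw [inv_mul_le_iff₀ (by positivity)]; linarith
  refine ((JetBound.const x θ).layer hφ hL₁ hL₂ ((firstIdx d m L).trans Function.Embedding.inl)
    (TwiceDifferentiable.const x) hs0 h₁).mono ?_ ?_ ?_
  · have : (√(d : ℝ))⁻¹ * (R * √(m : ℝ) * ‖x‖) ≤ R * √(m : ℝ) * B := by
      calc _ = R * √(m : ℝ) * ((√(d : ℝ))⁻¹ * ‖x‖) := by ring
        _ ≤ _ := by gcongr
    calc _ ≤ |φ 0| * √(m : ℝ) + K * (R * √(m : ℝ) * B) := by gcongr
      _ = _ := by ring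
  · rw [mul_zero, zero_add]; gcongr
  · simp only [mul_zero, zero_add, add_zero]; gcongr

/-- Bounds on the derivatives of the network in terms of the operator norms of the weights. -/
theorem exists_bound_fderiv_net (hφ : SmoothActivation φ) {R B : ℝ} (hR : 0 ≤ R) (hB : 0 ≤ B)
    (L : ℕ) :
    ∃ α β γ : ℝ, 0 ≤ α ∧ 0 ≤ β ∧ 0 ≤ γ ∧ ∀ {d m : ℕ}, 1 ≤ d → 1 ≤ m →
      ∀ (θ : Param d m L) (r : ℝ), ‖firstOp d m L θ‖ ≤ R * √(m : ℝ) →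
        (∀ l, ‖hiddenOp d m L l θ‖ ≤ R * √(m : ℝ)) → ‖outOp d m L θ‖ ≤ r →
        ∀ x : EuclideanSpace ℝ (Fin d), ‖x‖ ≤ B * √(d : ℝ) →
          ‖fderiv ℝ (fun θ : Param d m L => net φ θ x) θ‖ ≤ r * β / √(m : ℝ) + α ∧
          ‖fderiv ℝ (fderiv ℝ fun θ : Param d m L => net φ θ x) θ‖ ≤
            (r * γ + 2 * β) / √(m : ℝ) := by
  obtain ⟨α, β, γ, hα, hβ, hγ, h⟩ := exists_jetBound_features hφ hR hB L
  refine ⟨α, β, γ, hα, hβ, hγ, fun {d m} hd hm θ r h₁ h₂ h₃ x hx => ?_⟩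
  have hu := twiceDifferentiable_features (m := m) (L := L) hφ x
  have hm1 : 1 ≤ √(m : ℝ) := Real.one_le_sqrt.2 (by exact_mod_cast hm)
  have hm0 : √(m : ℝ) ≠ 0 := by positivity
  have h4 := ((h hd hm θ h₁ h₂ x hx).bilinear (outOp d m L) (norm_readout_le _) hu h₃).const_smul
    (s := (√(m : ℝ))⁻¹) (by positivity) (hu.bilinear (outOp d m L))
  rw [net_eq]
  refine ⟨h4.norm_fderiv_le.trans_eq ?_, h4.norm_fderiv2_le.trans_eq ?_⟩
  · field_simp
  · field_simp

end Network

/-! ### Passing from Fréchet derivatives to gradients -/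

section Gradient

variable {E : Type*} [NormedAddCommGroup E] [InnerProductSpace ℝ E] [CompleteSpace E]

/-- The inverse of the Riesz isomorphism, as a real linear map. -/
def rieszInv (E : Type*) [NormedAddCommGroup E] [InnerProductSpace ℝ E] [CompleteSpace E] :
    StrongDual ℝ E →L[ℝ] E :=
  LinearMap.mkContinuous
    { toFun := fun p => (InnerProductSpace.toDual ℝ E).symm p
      map_add' := fun p q => map_add _ p q
      map_smul' := fun c p => by simp } 1 fun p => by simp

theorem gradient_eq_rieszInv (f : E → ℝ) : gradient f = fun θ => rieszInv E (fderiv ℝ f θ) := rfl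

theorem norm_rieszInv_le : ‖rieszInv E‖ ≤ 1 := LinearMap.mkContinuous_norm_le _ zero_le_one _

theorem norm_gradient_le (f : E → ℝ) (θ : E) : ‖gradient f θ‖ ≤ ‖fderiv ℝ f θ‖ := by
  simp [gradient]

theorem inner_gradient (f : E → ℝ) (θ δ : E) : inner ℝ δ (gradient f θ) = fderiv ℝ f θ δ := by
  rw [real_inner_comm]; simp [gradient]

theorem TwiceDifferentiable.differentiable_gradient {f : E → ℝ} (hf : TwiceDifferentiable f) :
    Differentiable ℝ (gradient f) := by
  have h2 := hf.differentiable_fderiv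
  rw [gradient_eq_rieszInv]
  fun_prop

theorem TwiceDifferentiable.norm_fderiv_gradient_le {f : E → ℝ} (hf : TwiceDifferentiable f)
    (θ : E) : ‖fderiv ℝ (gradient f) θ‖ ≤ ‖fderiv ℝ (fderiv ℝ f) θ‖ := by
  rw [gradient_eq_rieszInv]
  have : fderiv ℝ (fun θ => rieszInv E (fderiv ℝ f θ)) θ =
      (rieszInv E).comp (fderiv ℝ (fderiv ℝ f) θ) :=
    ((rieszInv E).hasFDerivAt.comp θ (hf.differentiable_fderiv θ).hasFDerivAt).fderiv
  rw [this]
  refine (ContinuousLinearMap.opNorm_comp_le _ _).trans ?_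
  exact mul_le_of_le_one_left (norm_nonneg _) norm_rieszInv_le

end Gradient

/-! ### Strong convexity composed with an almost linear function -/

section Convexity

/-- Subtract the quadratic lower bound from `g` and apply the mean value theorem twice, first to the
difference and then to `g'`. The increment becomes `t * (q - p)^2 * (g'' η - a)`, which is
nonnegative. -/
theorem LipschitzStronglyConvexOn.le_of_convex {g : ℝ → ℝ} {lam a : ℝ} {S : Set ℝ}
    (hg : LipschitzStronglyConvexOn g lam a S) (hS : Convex ℝ S) {p q : ℝ} (hp : p ∈ S)
    (hq : q ∈ S) : g p + deriv g p * (q - p) + a / 2 * (q - p) ^ 2 ≤ g q := by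
  have hd : ∀ u ∈ S, HasDerivAt (fun u => g u - deriv g p * (u - p) - a / 2 * (u - p) ^ 2)
      (deriv g u - deriv g p - a * (u - p)) u := fun u hu => by
    have h1 := (hg u hu).1.hasDerivAt
    have h2 := (hasDerivAt_id' u).sub_const p
    refine ((h1.sub (h2.const_mul (deriv g p))).sub ((h2.pow 2).const_mul (a / 2))).congr_deriv ?_
    norm_num
    ring
  obtain ⟨ξ, hξ, e⟩ := domain_mvt (fun u hu => (hd u hu).hasFDerivAt.hasFDerivWithinAt) hS hp hq
  have hξS := hS.segment_subset hp hq hξ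
  obtain ⟨η, hη, e'⟩ := domain_mvt
    (fun u hu => (hg u hu).2.1.hasDerivAt.hasFDerivAt.hasFDerivWithinAt) hS hp hξS
  have hη := (hg η (hS.segment_subset hp hξS hη)).2.2.2
  simp only [ContinuousLinearMap.toSpanSingleton_apply, smul_eq_mul] at e e'
  rw [segment_eq_image] at hξ
  obtain ⟨t, ht, rfl⟩ := hξ
  simp only [smul_eq_mul] at e e'
  have h3 : 0 ≤ t * (q - p) ^ 2 * (deriv (deriv g) η - a) :=
    mul_nonneg (mul_nonneg ht.1 (sq_nonneg _)) (by linarith)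
  rw [e'] at e
  nlinarith [e, h3]

variable {E : Type*} [NormedAddCommGroup E] [InnerProductSpace ℝ E] [CompleteSpace E]

/-- Composition of a strongly convex function with an almost linear one. -/
theorem LipschitzStronglyConvexOn.almost_convex_comp {f : E → ℝ} (hf : TwiceDifferentiable f)
    {θ₀ : E} {ρ ϱ h lam a : ℝ} (hh : 0 ≤ h) (ha : 0 < a)
    (hgrad : ∀ θ ∈ Metric.closedBall θ₀ ρ, ‖gradient f θ‖ ≤ ϱ)
    (hhess : ∀ θ ∈ Metric.closedBall θ₀ ρ, ‖fderiv ℝ (gradient f) θ‖ ≤ h / 2)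
    {g : ℝ → ℝ} (hg : LipschitzStronglyConvexOn g lam a (f '' Metric.closedBall θ₀ ρ))
    {θt θ' θ'' : E} (ht : θt ∈ Metric.closedBall θ₀ ρ) (h' : θ' ∈ Metric.closedBall θ₀ ρ)
    (h'' : θ'' ∈ Metric.closedBall θ₀ ρ) :
    g (f θt) + deriv g (f θt) * fderiv ℝ f θt (θ' - θt) +
        1 / 2 * (a * inner ℝ (θ' - θt) (gradient f θ'') ^ 2 -
          4 * (4 * a * ϱ * ρ + lam) * h * ρ ^ 2) ≤ g (f θ') := by
  have hcb := convex_closedBall θ₀ ρ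
  have hρ : 0 ≤ ρ := dist_nonneg.trans ht
  have hϱ : 0 ≤ ϱ := (norm_nonneg _).trans (hgrad _ ht)
  -- The hypotheses on `g` hold only at attained predictions. These form an interval, as the
  -- continuous image of a connected ball, so the mean value points stay among them.
  have hconv : Convex ℝ (f '' Metric.closedBall θ₀ ρ) := by
    rw [Real.convex_iff_isPreconnected]
    exact hcb.isPreconnected.image f hf.differentiable.continuous.continuousOn
  have hdist : ∀ x ∈ Metric.closedBall θ₀ ρ, ∀ y ∈ Metric.closedBall θ₀ ρ, ‖y - x‖ ≤ 2 * ρ := by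
    intro x hx y hy
    rw [← dist_eq_norm]
    have := dist_triangle_right y x θ₀
    rw [Metric.mem_closedBall] at hx hy
    linarith
  -- The Hessian bound `h / 2` times the diameter `2 * ρ`. The half makes the error of the linear
  -- term exactly the `lam` part of the allowed error.
  have hlip : ∀ x ∈ Metric.closedBall θ₀ ρ, ∀ y ∈ Metric.closedBall θ₀ ρ,
      ‖gradient f y - gradient f x‖ ≤ h * ρ := by
    intro x hx y hy
    refine (hcb.norm_image_sub_le_of_norm_fderiv_le
      (fun z _ => hf.differentiable_gradient z) hhess hx hy).trans ?_
    calc h / 2 * ‖y - x‖ ≤ h / 2 * (2 * ρ) := by gcongr; exact hdist x hx y hy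
      _ = h * ρ := by ring
  obtain ⟨ξ, hξ, e⟩ := domain_mvt
    (fun z _ => (hf.differentiable z).hasFDerivAt.hasFDerivWithinAt) hcb ht h'
  have hξ := hcb.segment_subset ht h' hξ
  have key := hg.le_of_convex hconv (Set.mem_image_of_mem f ht) (Set.mem_image_of_mem f h')
  have hlam := (hg _ (Set.mem_image_of_mem f ht)).2.2.1
  rw [← inner_gradient] at e ⊢
  rw [e] at key
  set δ := θ' - θt
  have hδ : ‖δ‖ ≤ 2 * ρ := hdist _ ht _ h'
  have hδ0 := norm_nonneg δ
  have d1 : |inner ℝ δ (gradient f ξ) - inner ℝ δ (gradient f θt)| ≤ 2 * ρ * (h * ρ) := by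
    rw [← inner_sub_right]
    exact (abs_real_inner_le_norm _ _).trans
      (mul_le_mul hδ (hlip _ ht _ hξ) (norm_nonneg _) (by positivity))
  have d2 : |inner ℝ δ (gradient f ξ) - inner ℝ δ (gradient f θ'')| ≤ 2 * ρ * (h * ρ) := by
    rw [← inner_sub_right]
    exact (abs_real_inner_le_norm _ _).trans
      (mul_le_mul hδ (hlip _ h'' _ hξ) (norm_nonneg _) (by positivity))
  have d3 : |inner ℝ δ (gradient f ξ) + inner ℝ δ (gradient f θ'')| ≤ 2 * ρ * (2 * ϱ) := by
    rw [← inner_add_right]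
    refine (abs_real_inner_le_norm _ _).trans
      (mul_le_mul hδ ((norm_add_le _ _).trans ?_) (norm_nonneg _) (by positivity))
    linarith [hgrad ξ hξ, hgrad θ'' h'']
  generalize inner ℝ δ (gradient f ξ) = A at *
  generalize inner ℝ δ (gradient f θ'') = A'' at *
  generalize inner ℝ δ (gradient f θt) = At at *
  have k1 : |deriv g (f θt) * (A - At)| ≤ lam * (2 * ρ * (h * ρ)) := by
    rw [abs_mul]
    exact mul_le_mul hlam d1 (abs_nonneg _) ((abs_nonneg _).trans hlam)
  -- The quadratic term changes by a difference of squares, factored so that one factor is small and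
  -- the other bounded by the gradients.
  have k2 : |(A - A'') * (A + A'')| ≤ 2 * ρ * (h * ρ) * (2 * ρ * (2 * ϱ)) := by
    rw [abs_mul]
    exact mul_le_mul d2 d3 (abs_nonneg _) (by positivity)
  have k3 := mul_le_mul_of_nonneg_left (neg_le_of_abs_le k2) ha.le
  have k4 := neg_le_of_abs_le k1
  have k5 : 0 ≤ a * ϱ * ρ * h * ρ ^ 2 := by positivity
  nlinarith [key, k3, k4, k5]

end Convexity

/-! ### Operator norm of a Gaussian matrix -/

section Gaussian

variable {α β ι : Type*} [Fintype α] [Fintype β] [Fintype ι]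

/-- The exponential moment of a linear combination of independent standard Gaussians. -/
theorem lintegral_exp_sum_gaussian (g : α ↪ ι) (c : α → ℝ) :
    ∫⁻ ω, ENNReal.ofReal (Real.exp (∑ p, c p * ω (g p)))
        ∂(Measure.pi fun _ : ι => gaussianReal 0 1) =
      ENNReal.ofReal (Real.exp ((∑ p, c p ^ 2) / 2)) := by
  set μ := Measure.pi fun _ : ι => gaussianReal 0 1
  set X : α → (ι → ℝ) → ℝ := fun p ω => c p * ω (g p)
  have hind : iIndepFun X μ := by
    have h1 : iIndepFun (fun i (ω : ι → ℝ) => ω i) μ :=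
      iIndepFun_pi (X := fun _ => id) fun _ => aemeasurable_id
    exact (h1.precomp g.injective).comp (fun p x => c p * x) fun p => by fun_prop
  have hX : ∀ p, mgf (X p) μ 1 = Real.exp (c p ^ 2 / 2) := fun p => by
    have h2 : μ.map (fun ω => ω (g p)) = gaussianReal 0 1 :=
      (measurePreserving_eval (fun _ : ι => gaussianReal 0 1) (g p)).map_eq
    rw [show X p = fun ω => c p * ω (g p) from rfl, mgf_const_mul, mgf_gaussianReal h2]
    simp
  have hm := hind.mgf_sum (t := 1) (fun p => by fun_prop) Finset.univ
  simp_rw [hX, ← Real.exp_sum, ← Finset.sum_div] at hm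
  have hm' : ∫ ω, Real.exp (∑ p, c p * ω (g p)) ∂μ = Real.exp ((∑ p, c p ^ 2) / 2) := by
    rw [← hm]; simp [mgf, X]
  rw [← hm', ofReal_integral_eq_lintegral_ofReal]
  -- Integrability is automatic: otherwise the integral would be 0 by convention, whereas it equals
  -- a positive exponential.
  · refine not_not.1 fun h => (Real.exp_pos ((∑ p, c p ^ 2) / 2)).ne' ?_
    rw [← hm', integral_undef h]
  · exact Filter.Eventually.of_forall fun _ => (Real.exp_pos _).le

/-- The Gaussian matrix with entries at the positions `g`. -/
def gaussianOp (g : α × β ↪ ι) (ω : ι → ℝ) : EuclideanSpace ℝ β →L[ℝ] EuclideanSpace ℝ α :=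
  weightOp g (WithLp.toLp 2 ω)

theorem continuous_gaussianOp (g : α × β ↪ ι) : Continuous (gaussianOp g) :=
  (weightOp g).continuous.comp (PiLp.continuous_toLp 2 _)

theorem inner_gaussianOp (g : α × β ↪ ι) (ω : ι → ℝ) (u : EuclideanSpace ℝ β)
    (w : EuclideanSpace ℝ α) :
    inner ℝ w (gaussianOp g ω u) = ∑ p : α × β, w p.1 * u p.2 * ω (g p) := by
  rw [Fintype.sum_prod_type, PiLp.inner_apply]
  refine Finset.sum_congr rfl fun i _ => ?_
  simp only [gaussianOp, weightOp_apply, RCLike.inner_apply, conj_trivial, Finset.sum_mul]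
  exact Finset.sum_congr rfl fun j _ => by ring

/-- The pairing is a centred Gaussian of variance `‖w‖^2 * ‖u‖^2 ≤ 1`. -/
theorem lintegral_exp_inner_gaussianOp_le (g : α × β ↪ ι) (s : ℝ) {u : EuclideanSpace ℝ β}
    {w : EuclideanSpace ℝ α} (hu : ‖u‖ ≤ 1) (hw : ‖w‖ ≤ 1) :
    ∫⁻ ω, ENNReal.ofReal (Real.exp (s * inner ℝ w (gaussianOp g ω u)))
        ∂(Measure.pi fun _ : ι => gaussianReal 0 1) ≤ ENNReal.ofReal (Real.exp (s ^ 2 / 2)) := by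
  have h := lintegral_exp_sum_gaussian g fun p : α × β => s * (w p.1 * u p.2)
  simp_rw [inner_gaussianOp, Finset.mul_sum, ← mul_assoc] at h ⊢
  rw [h]
  have e : ∑ p : α × β, (s * w p.1 * u p.2) ^ 2 = s ^ 2 * (‖w‖ ^ 2 * ‖u‖ ^ 2) := by
    simp_rw [EuclideanSpace.norm_sq_eq, Fintype.sum_prod_type, Finset.sum_mul_sum, Finset.mul_sum,
      Real.norm_eq_abs, sq_abs]
    exact Finset.sum_congr rfl fun i _ => Finset.sum_congr rfl fun j _ => by ring
  rw [e]
  gcongr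
  have h1 : ‖w‖ ^ 2 ≤ 1 := pow_le_one₀ (norm_nonneg _) hw
  have h2 : ‖u‖ ^ 2 ≤ 1 := pow_le_one₀ (norm_nonneg _) hu
  have h3 : ‖w‖ ^ 2 * ‖u‖ ^ 2 ≤ 1 := mul_le_one₀ h1 (sq_nonneg _) h2
  nlinarith [sq_nonneg s]

theorem ball_smul_subset_ball {V : Type*} [NormedAddCommGroup V] [NormedSpace ℝ V] {v : V}
    (hv : ‖v‖ ≤ 1) : Metric.ball ((3 / 4 : ℝ) • v) (1 / 4) ⊆ Metric.ball 0 1 := by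
  refine Metric.ball_subset_ball' ?_
  rw [dist_zero_right, norm_smul]
  norm_num
  linarith

/-- An operator of large norm has large matrix coefficients on a product of balls. -/
theorem exists_ball_inner_lower_bound {U W : Type*} [NormedAddCommGroup U]
    [InnerProductSpace ℝ U] [NormedAddCommGroup W] [InnerProductSpace ℝ W] (A : U →L[ℝ] W)
    {t : ℝ} (ht : 0 ≤ t) (hA : t < ‖A‖) :
    ∃ (u₀ : U) (w₀ : W), Metric.ball u₀ (1 / 4) ⊆ Metric.ball 0 1 ∧
      Metric.ball w₀ (1 / 4) ⊆ Metric.ball 0 1 ∧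
      ∀ u ∈ Metric.ball u₀ (1 / 4), ∀ w ∈ Metric.ball w₀ (1 / 4), t / 16 ≤ inner ℝ w (A u) := by
  have hpos : 0 < ‖A‖ := ht.trans_lt hA
  -- With a near-maximizer `x`, the pairing is at least `(9/16 * 15/16 - 3/16 - 3/16 - 1/16) * ‖A‖ =
  -- 23/256 * ‖A‖`, which exceeds `t / 16`.
  obtain ⟨x, hx, hAx⟩ := A.exists_lt_apply_of_lt_opNorm (r := 15 / 16 * ‖A‖) (by linarith)
  have hAx0 : 0 < ‖A x‖ := lt_trans (by positivity) hAx
  set y : W := (‖A x‖)⁻¹ • A x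
  have hy : ‖y‖ = 1 := by simp [y, norm_smul, hAx0.ne']
  have hyx : inner ℝ y (A x) = ‖A x‖ := by
    simp only [y, real_inner_smul_left, real_inner_self_eq_norm_sq]
    field_simp
  refine ⟨(3 / 4 : ℝ) • x, (3 / 4 : ℝ) • y, ball_smul_subset_ball hx.le,
    ball_smul_subset_ball hy.le, fun u hu w hw => ?_⟩
  rw [mem_ball_iff_norm] at hu hw
  have hu' : u = (3 / 4 : ℝ) • x + (u - (3 / 4 : ℝ) • x) := by abel
  have hw' : w = (3 / 4 : ℝ) • y + (w - (3 / 4 : ℝ) • y) := by abel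
  set p := u - (3 / 4 : ℝ) • x
  set q := w - (3 / 4 : ℝ) • y
  have hb : ∀ (a : W) (b : U) (r : ℝ), ‖a‖ * ‖b‖ ≤ r → -(r * ‖A‖) ≤ inner ℝ a (A b) := by
    intro a b r hr
    refine neg_le_of_abs_le ((abs_real_inner_le_norm _ _).trans ?_)
    calc ‖a‖ * ‖A b‖ ≤ ‖a‖ * (‖A‖ * ‖b‖) := by gcongr; exact A.le_opNorm b
      _ = ‖a‖ * ‖b‖ * ‖A‖ := by ring
      _ ≤ _ := by gcongr
  have b1 := hb y p (1 / 4) (by rw [hy]; linarith)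
  have b2 := hb q x (1 / 4) (by
    calc ‖q‖ * ‖x‖ ≤ 1 / 4 * 1 := by gcongr
      _ = _ := by norm_num)
  have b3 := hb q p (1 / 16) (by
    calc ‖q‖ * ‖p‖ ≤ 1 / 4 * (1 / 4) := by gcongr
      _ = _ := by norm_num)
  rw [hu', hw']
  simp only [map_add, map_smul, inner_add_left, inner_add_right, real_inner_smul_left,
    real_inner_smul_right, hyx]
  linarith

/-- An average over balls replaces a net. The mean of `exp (s * ⟪w, A u⟫)` over pairs of unit
vectors' balls has expectation at most `exp (s^2 / 2)`. If `‖A‖ > t`, the integrand is at least `exp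
(s * t / 16)` on a product of balls of radius `1/4`, whose volume fraction is `4` to the minus total
dimension. Markov's inequality concludes. -/
theorem measure_lt_norm_gaussianOp_le (g : α × β ↪ ι) {s t : ℝ} (hs : 0 ≤ s) (ht : 0 ≤ t) :
    (Measure.pi fun _ : ι => gaussianReal 0 1) {ω | t < ‖gaussianOp g ω‖} ≤
      ENNReal.ofReal (4 ^ (Fintype.card α + Fintype.card β) * Real.exp (s ^ 2 / 2 - s * t / 16)) := by
  set μ := Measure.pi fun _ : ι => gaussianReal 0 1
  set Q : Measure (EuclideanSpace ℝ β × EuclideanSpace ℝ α) :=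
    (volume.restrict (Metric.ball 0 1)).prod (volume.restrict (Metric.ball 0 1))
  set F : (ι → ℝ) → EuclideanSpace ℝ β × EuclideanSpace ℝ α → ENNReal := fun ω q =>
    ENNReal.ofReal (Real.exp (s * inner ℝ q.2 (gaussianOp g ω q.1)))
  set V := (volume (Metric.ball (0 : EuclideanSpace ℝ β) 1)) *
    (volume (Metric.ball (0 : EuclideanSpace ℝ α) 1))
  have hV0 : V ≠ 0 := mul_ne_zero (Metric.measure_ball_pos _ _ one_pos).ne'
    (Metric.measure_ball_pos _ _ one_pos).ne'
  have hVt : V ≠ ⊤ := ENNReal.mul_ne_top measure_ball_lt_top.ne measure_ball_lt_top.ne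
  have hQ : Q Set.univ = V := by
    rw [← Set.univ_prod_univ, Measure.prod_prod, Measure.restrict_apply_univ,
      Measure.restrict_apply_univ]
  have hF : Measurable (Function.uncurry F) := by
    refine (ENNReal.continuous_ofReal.comp (Real.continuous_exp.comp ?_)).measurable
    have h1 : Continuous fun z : (ι → ℝ) × EuclideanSpace ℝ β × EuclideanSpace ℝ α =>
        gaussianOp g z.1 := (continuous_gaussianOp g).comp continuous_fst
    fun_prop
  have hupper : ∫⁻ ω, ∫⁻ q, F ω q ∂Q ∂μ ≤ ENNReal.ofReal (Real.exp (s ^ 2 / 2)) * V := by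
    rw [lintegral_lintegral_swap hF.aemeasurable, ← hQ, ← lintegral_const]
    refine lintegral_mono_ae ?_
    have hmem : ∀ᵐ q ∂Q, q ∈ Metric.ball (0 : EuclideanSpace ℝ β) 1 ×ˢ
        Metric.ball (0 : EuclideanSpace ℝ α) 1 := by
      simp only [Q]
      rw [Measure.prod_restrict]
      exact ae_restrict_mem (measurableSet_ball.prod measurableSet_ball)
    filter_upwards [hmem] with q hq
    exact lintegral_exp_inner_gaussianOp_le g s (mem_ball_zero_iff.1 hq.1).le
      (mem_ball_zero_iff.1 hq.2).le
  set κ := ENNReal.ofReal (Real.exp (s * t / 16) * (1 / 4) ^ (Fintype.card α + Fintype.card β))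
  have hlower : ∀ ω ∈ {ω | t < ‖gaussianOp g ω‖}, κ * V ≤ ∫⁻ q, F ω q ∂Q := by
    intro ω hω
    obtain ⟨u₀, w₀, hu, hw, h⟩ := exists_ball_inner_lower_bound _ ht hω
    have hS : MeasurableSet (Metric.ball u₀ (1 / 4) ×ˢ Metric.ball w₀ (1 / 4)) :=
      measurableSet_ball.prod measurableSet_ball
    calc κ * V = ENNReal.ofReal (Real.exp (s * t / 16)) *
          Q (Metric.ball u₀ (1 / 4) ×ˢ Metric.ball w₀ (1 / 4)) := by
          rw [Measure.prod_prod, Measure.restrict_apply measurableSet_ball,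
            Measure.restrict_apply measurableSet_ball, Set.inter_eq_left.2 hu,
            Set.inter_eq_left.2 hw, Measure.addHaar_ball_of_pos _ u₀ (by norm_num),
            Measure.addHaar_ball_of_pos _ w₀ (by norm_num), finrank_euclideanSpace,
            finrank_euclideanSpace]
          simp only [κ, V]
          rw [ENNReal.ofReal_mul (Real.exp_pos _).le, pow_add,
            ENNReal.ofReal_mul (by positivity)]
          ring
      _ = ∫⁻ _ in Metric.ball u₀ (1 / 4) ×ˢ Metric.ball w₀ (1 / 4),
            ENNReal.ofReal (Real.exp (s * t / 16)) ∂Q := by rw [setLIntegral_const]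
      _ ≤ ∫⁻ q in Metric.ball u₀ (1 / 4) ×ˢ Metric.ball w₀ (1 / 4), F ω q ∂Q := by
          refine setLIntegral_mono' hS fun q hq => ?_
          have := h q.1 hq.1 q.2 hq.2
          simp only [F]
          gcongr
          rw [mul_div_assoc]
          gcongr
      _ ≤ _ := setLIntegral_le_lintegral _ _
  have hmarkov : κ * V * μ {ω | t < ‖gaussianOp g ω‖} ≤
      ENNReal.ofReal (Real.exp (s ^ 2 / 2)) * V := by
    refine le_trans ?_ ((mul_meas_ge_le_lintegral₀ hF.lintegral_prod_right'.aemeasurable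
      (κ * V)).trans hupper)
    exact mul_le_mul_right (measure_mono hlower) _
  have hκ : ENNReal.ofReal (4 ^ (Fintype.card α + Fintype.card β) *
      Real.exp (s ^ 2 / 2 - s * t / 16)) * κ = ENNReal.ofReal (Real.exp (s ^ 2 / 2)) := by
    rw [← ENNReal.ofReal_mul (by positivity)]
    congr 1
    rw [Real.exp_sub, one_div, inv_pow]
    field_simp
  have hκ0 : κ * V ≠ 0 := by
    refine mul_ne_zero ?_ hV0
    simp only [κ, ne_eq, ENNReal.ofReal_eq_zero, not_le]
    positivity
  have hκt : κ * V ≠ ⊤ := ENNReal.mul_ne_top ENNReal.ofReal_ne_top hVt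
  refine (ENNReal.mul_le_mul_iff_right hκ0 hκt).1 (hmarkov.trans_eq ?_)
  rw [← hκ]
  ring

theorem measure_norm_gaussianOp_le_exp {m : ℕ} (g : α × β ↪ ι) (hα : Fintype.card α ≤ m)
    (hβ : Fintype.card β ≤ m) :
    (Measure.pi fun _ : ι => gaussianReal 0 1) {ω | 80 * √(m : ℝ) < ‖gaussianOp g ω‖} ≤
      ENNReal.ofReal (Real.exp (-m)) := by
  refine (measure_lt_norm_gaussianOp_le g (s := √(m : ℝ)) (by positivity) (by positivity)).trans ?_
  refine ENNReal.ofReal_le_ofReal ?_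
  have hm : √(m : ℝ) * √(m : ℝ) = m := Real.mul_self_sqrt (by positivity)
  -- With `s = √m` and `t = 80 * √m` the exponent is `-9m/2`, while the volume factor is at most `16
  -- ^ m ≤ exp (3 * m)`.
  have e : √(m : ℝ) ^ 2 / 2 - √(m : ℝ) * (80 * √(m : ℝ)) / 16 = -(9 / 2) * m := by
    linear_combination (1 / 2 - 5) * hm
  have h4 : (16 : ℝ) ≤ Real.exp 3 := by
    have h1 := Real.exp_one_gt_d9
    calc (16 : ℝ) ≤ 2.7 ^ 3 := by norm_num
      _ ≤ Real.exp 1 ^ 3 := by gcongr; linarith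
      _ = Real.exp 3 := by rw [← Real.exp_nat_mul]; norm_num
  rw [e]
  calc (4 : ℝ) ^ (Fintype.card α + Fintype.card β) * Real.exp (-(9 / 2) * m)
      ≤ 4 ^ (2 * m) * Real.exp (-(9 / 2) * m) := by
        gcongr
        · norm_num
        · omega
    _ = 16 ^ m * Real.exp (-(9 / 2) * m) := by rw [pow_mul]; norm_num
    _ ≤ Real.exp 3 ^ m * Real.exp (-(9 / 2) * m) := by gcongr
    _ = Real.exp (3 * m + -(9 / 2) * m) := by rw [Real.exp_add, ← Real.exp_nat_mul, mul_comm 3]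
    _ ≤ Real.exp (-m) := by
        gcongr
        have : (0 : ℝ) ≤ m := by positivity
        linarith

end Gaussian

/-! ### Probability of the good event -/

section Initialization

variable {d m L : ℕ}

/-- The parameters whose weight matrices have operator norm `O(√m)`. -/
def goodInit (d m L : ℕ) : Set (Param d m L) :=
  {θ | ‖firstOp d m L θ‖ ≤ 80 * √(m : ℝ)} ∩
    (⋂ l, {θ | ‖hiddenOp d m L l θ‖ ≤ 80 * √(m : ℝ)}) ∩ {θ | ‖outOp d m L θ‖ ≤ 1}

theorem measurableSet_goodInit : MeasurableSet (goodInit d m L) := by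
  refine ((IsClosed.inter ?_ (isClosed_iInter fun l => ?_)).inter ?_).measurableSet
  · exact isClosed_le (firstOp d m L).continuous.norm continuous_const
  · exact isClosed_le (hiddenOp d m L l).continuous.norm continuous_const
  · exact isClosed_le (outOp d m L).continuous.norm continuous_const

theorem norm_outOp_assemble_le
    (p : (WeightIdx d m L → ℝ) × Metric.sphere (0 : EuclideanSpace ℝ (Fin m)) 1) :
    ‖outOp d m L (assemble p)‖ ≤ 1 := by
  refine ContinuousLinearMap.opNorm_le_bound _ zero_le_one fun u => ?_
  have h : outOp d m L (assemble p) u = inner ℝ u (p.2 : EuclideanSpace ℝ (Fin m)) := by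
    rw [PiLp.inner_apply]
    rfl
  rw [h]
  refine (norm_inner_le_norm _ _).trans_eq ?_
  rw [norm_eq_of_mem_sphere p.2, mul_comm]

/-- A union bound over the `L` Gaussian matrices. The condition on the output vector always holds,
and `d ≤ m` puts the first matrix under the same norm bound. -/
theorem initLaw_goodInit_ge (hL : 1 ≤ L) (hdm : d ≤ m)
    (ν : Measure (Metric.sphere (0 : EuclideanSpace ℝ (Fin m)) 1)) [IsProbabilityMeasure ν] :
    ENNReal.ofReal (1 - L * Real.exp (-m)) ≤ initLaw d m L ν (goodInit d m L) := by
  set μ := Measure.pi fun _ : WeightIdx d m L => gaussianReal 0 1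
  have hbad : initLaw d m L ν (goodInit d m L)ᶜ ≤ ENNReal.ofReal (L * Real.exp (-m)) := by
    rw [initLaw, Measure.map_apply (measurable_assemble d m L) measurableSet_goodInit.compl]
    let S₁ : Set (WeightIdx d m L → ℝ) := {ω | 80 * √(m : ℝ) < ‖gaussianOp (firstIdx d m L) ω‖}
    let S₂ : Fin (L - 1) → Set (WeightIdx d m L → ℝ) := fun l =>
      {ω | 80 * √(m : ℝ) < ‖gaussianOp (hiddenIdx d m L l) ω‖}
    have hsub : assemble ⁻¹' (goodInit d m L)ᶜ ⊆ (S₁ ∪ ⋃ l, S₂ l) ×ˢ Set.univ := by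
      intro p hp
      refine ⟨?_, trivial⟩
      by_contra hcon
      simp only [Set.mem_union, Set.mem_iUnion, not_or, not_exists] at hcon
      refine hp ⟨⟨?_, Set.mem_iInter.2 fun l => ?_⟩, norm_outOp_assemble_le p⟩
      · exact not_lt.1 (show ¬80 * √(m : ℝ) < ‖gaussianOp (firstIdx d m L) p.1‖ from hcon.1)
      · exact not_lt.1 (show ¬80 * √(m : ℝ) < ‖gaussianOp (hiddenIdx d m L l) p.1‖ from hcon.2 l)
    calc (μ.prod ν) (assemble ⁻¹' (goodInit d m L)ᶜ)
        ≤ (μ.prod ν) ((S₁ ∪ ⋃ l, S₂ l) ×ˢ Set.univ) := measure_mono hsub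
      _ = μ (S₁ ∪ ⋃ l, S₂ l) := by rw [Measure.prod_prod, measure_univ, mul_one]
      _ ≤ μ S₁ + ∑ l, μ (S₂ l) :=
          (measure_union_le _ _).trans (add_le_add le_rfl (measure_iUnion_fintype_le _ _))
      _ ≤ ENNReal.ofReal (Real.exp (-m)) + ∑ _l : Fin (L - 1), ENNReal.ofReal (Real.exp (-m)) := by
          gcongr with l
          · exact measure_norm_gaussianOp_le_exp _ (by simp) (by simpa using hdm)
          · exact measure_norm_gaussianOp_le_exp _ (by simp) (by simp)
      _ = ENNReal.ofReal (L * Real.exp (-m)) := by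
          rw [Finset.sum_const, Finset.card_univ, Fintype.card_fin, nsmul_eq_mul,
            ENNReal.ofReal_mul (by positivity), ENNReal.ofReal_natCast]
          obtain ⟨k, rfl⟩ := Nat.exists_eq_add_of_le' hL
          simp only [Nat.add_sub_cancel]
          push_cast
          ring
  have h := prob_compl_eq_one_sub (μ := initLaw d m L ν) measurableSet_goodInit.compl
  rw [compl_compl] at h
  rw [h, ENNReal.ofReal_sub _ (by positivity), ENNReal.ofReal_one]
  gcongr

end Initialization

/-! ### From the initialization to the ball, and from one example to the batch -/

theorem norm_apply_le_of_mem_closedBall {E V : Type*} [NormedAddCommGroup E] [NormedSpace ℝ E]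
    [NormedAddCommGroup V] [NormedSpace ℝ V] (T : E →L[ℝ] V) (hT : ‖T‖ ≤ 1) {θ θ₀ : E} {ρ b : ℝ}
    (hθ : θ ∈ Metric.closedBall θ₀ ρ) (h₀ : ‖T θ₀‖ ≤ b) : ‖T θ‖ ≤ b + ρ := by
  have h1 : ‖T (θ - θ₀)‖ ≤ 1 * ρ :=
    T.le_of_opNorm_le_of_le hT (by rwa [← mem_closedBall_iff_norm])
  have h2 : T θ = T θ₀ + T (θ - θ₀) := by rw [← map_add, add_sub_cancel]
  rw [h2]
  refine (norm_add_le _ _).trans ?_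
  linarith

theorem inner_gradient_batchLoss {φ : ℝ → ℝ} (hφ : SmoothActivation φ) {d m L n : ℕ}
    {ℓ : ℝ → ℝ → ℝ} {x : Fin n → EuclideanSpace ℝ (Fin d)} {y : Fin n → ℝ} {θ : Param d m L}
    (hℓ : ∀ i, DifferentiableAt ℝ (ℓ (y i)) (net φ θ (x i))) (δ : Param d m L) :
    inner ℝ δ (gradient (batchLoss φ ℓ x y) θ) =
      (n : ℝ)⁻¹ * ∑ i, deriv (ℓ (y i)) (net φ θ (x i)) *
        fderiv ℝ (fun θ : Param d m L => net φ θ (x i)) θ δ := by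
  rw [inner_gradient]
  have h : HasFDerivAt (batchLoss φ ℓ x y : Param d m L → ℝ)
      ((n : ℝ)⁻¹ • ∑ i, deriv (ℓ (y i)) (net φ θ (x i)) •
        fderiv ℝ (fun θ : Param d m L => net φ θ (x i)) θ) θ := by
    refine HasFDerivAt.const_mul (HasFDerivAt.fun_sum fun i _ => ?_) _
    exact (hℓ i).hasDerivAt.comp_hasFDerivAt θ
      ((twiceDifferentiable_net hφ (x i)).differentiable θ).hasFDerivAt
  rw [h.fderiv]
  simp

/-- The error in the single-example inequality is the same for every example, so averaging preserves
it. -/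
theorem batchLoss_almost_convex {φ : ℝ → ℝ} (hφ : SmoothActivation φ) {d m L n : ℕ} (hn : 1 ≤ n)
    {x : Fin n → EuclideanSpace ℝ (Fin d)} {y : Fin n → ℝ} {ℓ : ℝ → ℝ → ℝ} {lam a : ℝ} (ha : 0 < a)
    {θ₀ : Param d m L} {ρ ϱ h : ℝ} (hh : 0 ≤ h)
    (hgrad : ∀ i, ∀ θ ∈ Metric.closedBall θ₀ ρ, ‖netGrad φ (x i) θ‖ ≤ ϱ)
    (hhess : ∀ i, ∀ θ ∈ Metric.closedBall θ₀ ρ, ‖netHess φ (x i) θ‖ ≤ h / 2)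
    (hℓ : ∀ i, LipschitzStronglyConvexOn (ℓ (y i)) lam a
      ((fun θ => net φ θ (x i)) '' Metric.closedBall θ₀ ρ))
    {θt θ' θ'' : Param d m L} (ht : θt ∈ Metric.closedBall θ₀ ρ)
    (h' : θ' ∈ Metric.closedBall θ₀ ρ) (h'' : θ'' ∈ Metric.closedBall θ₀ ρ) :
    batchLoss φ ℓ x y θt + inner ℝ (θ' - θt) (gradient (batchLoss φ ℓ x y) θt) +
        1 / 2 * (a * ((n : ℝ)⁻¹ * ∑ i, inner ℝ (θ' - θt) (netGrad φ (x i) θ'') ^ 2) -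
          4 * (4 * a * ϱ * ρ + lam) * h * ρ ^ 2) ≤ batchLoss φ ℓ x y θ' := by
  rw [inner_gradient_batchLoss hφ fun i => (hℓ i _ (Set.mem_image_of_mem _ ht)).1]
  have hn0 : (n : ℝ) ≠ 0 := by positivity
  have hsum := Finset.sum_le_sum fun i (_ : i ∈ Finset.univ) =>
    (hℓ i).almost_convex_comp (twiceDifferentiable_net hφ (x i)) hh ha (hgrad i) (hhess i) ht h' h''
  simp only [Finset.sum_add_distrib, ← Finset.mul_sum, Finset.sum_sub_distrib, Finset.sum_const,
    Finset.card_univ, Fintype.card_fin, nsmul_eq_mul] at hsum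
  have := mul_le_mul_of_nonneg_left hsum (show 0 ≤ (n : ℝ)⁻¹ by positivity)
  refine le_trans (le_of_eq ?_) this
  simp only [batchLoss, netGrad]
  field_simp

end OnlineNN

end

theorem mainTheorem2 (L : ℕ) (hL : 1 ≤ L) (φ : ℝ → ℝ) (hφ : OnlineNN.SmoothActivation φ)
    (B : ℝ) (hB : 0 < B) :
    ∃ (C c ϱ : ℝ) (cH : ℝ → ℝ), 0 < C ∧ 0 < c ∧ 0 < ϱ ∧
      (∀ ρ : ℝ, 0 < ρ → 0 < cH ρ ∧ cH ρ ≤ C * (max 1 ρ) ^ (3 * L)) ∧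
      ∀ (ρ : ℝ), 0 < ρ → ∀ (d : ℕ), 1 ≤ d → ∃ m₀ : ℕ, ∀ (m : ℕ), m₀ ≤ m →
        ∀ (ν : MeasureTheory.Measure (Metric.sphere (0 : EuclideanSpace ℝ (Fin m)) 1)),
          MeasureTheory.IsProbabilityMeasure ν →
        ∃ E : Set (OnlineNN.Param d m L), MeasurableSet E ∧
          ENNReal.ofReal (1 - C * Real.exp (-c * m)) ≤ OnlineNN.initLaw d m L ν E ∧
          ∀ θ₀ ∈ E,
            -- `cH` and `ϱ` bound the Hessian and the gradient of the network on the ball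
            (∀ θ ∈ Metric.closedBall θ₀ ρ, ∀ x : EuclideanSpace ℝ (Fin d), ‖x‖ ≤ B * √(d : ℝ) →
              ‖OnlineNN.netHess φ x θ‖ ≤ cH ρ / √(m : ℝ) ∧ ‖OnlineNN.netGrad φ x θ‖ ≤ ϱ) ∧
            -- almost strong convexity of the loss
            (∀ (n : ℕ), 1 ≤ n →
              ∀ (x : Fin n → EuclideanSpace ℝ (Fin d)), (∀ i, ‖x i‖ ≤ B * √(d : ℝ)) →
              ∀ (y : Fin n → ℝ) (ℓ : ℝ → ℝ → ℝ) (lam a : ℝ), 0 < lam → 0 < a →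
              (∀ i, OnlineNN.LipschitzStronglyConvexOn (ℓ (y i)) lam a
                ((fun θ => OnlineNN.net φ θ (x i)) '' Metric.closedBall θ₀ ρ)) →
              ∀ θt ∈ Metric.closedBall θ₀ ρ, ∀ θ' ∈ Metric.closedBall θ₀ ρ,
              ∀ θ'' ∈ Metric.closedBall θ₀ ρ,
                OnlineNN.batchLoss φ ℓ x y θ' ≥
                  OnlineNN.batchLoss φ ℓ x y θt
                    + inner ℝ (θ' - θt) (gradient (OnlineNN.batchLoss φ ℓ x y) θt)
                    + (1 / 2) *
                      (a * ((n : ℝ)⁻¹ *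
                          ∑ i, (inner ℝ (θ' - θt) (OnlineNN.netGrad φ (x i) θ'')) ^ 2)
                        - 4 * (4 * a * ϱ * ρ + lam) * cH ρ * ρ ^ 2 / √(m : ℝ))) := by
  -- `R = 81` covers `80 * √m` at initialization plus a displacement `ρ ≤ √m`, so the constants do
  -- not see `ρ`.
  obtain ⟨α, β, γ, hα, hβ, hγ, hnet⟩ := OnlineNN.exists_bound_fderiv_net hφ (R := 81) (B := B)
    (by norm_num) hB.le L
  have hL0 : (0 : ℝ) ≤ L := by positivity
  -- In `C`, `L` pays for the union bound and the rest for `cH`. In `cH`, the factor 2 provides the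
  -- Hessian bound `h / 2` and the `+ 1` ensures positivity. The threshold on `m` gives `d ≤ m` and
  -- `ρ ≤ √m`.
  refine ⟨L + (4 * γ + 4 * β + 1), 1, 2 * β + α + 1, fun ρ => 2 * ((1 + ρ) * γ + 2 * β) + 1,
    by positivity, one_pos, by positivity, fun ρ hρ => ⟨by positivity, ?_⟩,
    fun ρ hρ d hd => ⟨max d ⌈ρ ^ 2⌉₊, fun m hm ν hν => ?_⟩⟩
  · have h1 : (1 : ℝ) ≤ max 1 ρ := le_max_left _ _
    have h2 : max 1 ρ ≤ max 1 ρ ^ (3 * L) := le_self_pow₀ h1 (by omega)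
    calc 2 * ((1 + ρ) * γ + 2 * β) + 1
        ≤ 2 * ((max 1 ρ + max 1 ρ) * γ + 2 * (β * max 1 ρ)) + max 1 ρ := by
          gcongr
          · exact le_max_right _ _
          · exact le_mul_of_one_le_right hβ h1
      _ = (4 * γ + 4 * β + 1) * max 1 ρ := by ring
      _ ≤ (L + (4 * γ + 4 * β + 1)) * max 1 ρ ^ (3 * L) := by
          exact mul_le_mul (by linarith) h2 (by positivity) (by positivity)
  have hdm : d ≤ m := (le_max_left _ _).trans hm
  have hm1 : 1 ≤ m := hd.trans hdm
  have hs1 : 1 ≤ √(m : ℝ) := Real.one_le_sqrt.2 (by exact_mod_cast hm1)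
  have hs0 : 0 < √(m : ℝ) := by positivity
  have hρm : ρ ≤ √(m : ℝ) :=
    Real.le_sqrt_of_sq_le ((Nat.le_ceil _).trans (by exact_mod_cast (le_max_right _ _).trans hm))
  refine ⟨OnlineNN.goodInit d m L, OnlineNN.measurableSet_goodInit, ?_, fun θ₀ hθ₀ => ?_⟩
  · refine le_trans (ENNReal.ofReal_le_ofReal ?_) (OnlineNN.initLaw_goodInit_ge hL hdm ν)
    rw [neg_one_mul]
    gcongr
    linarith
  have hbound : ∀ θ ∈ Metric.closedBall θ₀ ρ, ∀ x : EuclideanSpace ℝ (Fin d),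
      ‖x‖ ≤ B * √(d : ℝ) →
      ‖OnlineNN.netHess φ x θ‖ ≤ (2 * ((1 + ρ) * γ + 2 * β) + 1) / √(m : ℝ) / 2 ∧
        ‖OnlineNN.netGrad φ x θ‖ ≤ 2 * β + α + 1 := by
    intro θ hθ x hx
    have hf := OnlineNN.norm_apply_le_of_mem_closedBall (OnlineNN.firstOp d m L)
      (OnlineNN.norm_weightOp_le _) hθ hθ₀.1.1
    have hh := fun l => OnlineNN.norm_apply_le_of_mem_closedBall (OnlineNN.hiddenOp d m L l)
      (OnlineNN.norm_weightOp_le _) hθ (Set.mem_iInter.1 hθ₀.1.2 l)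
    have ho := OnlineNN.norm_apply_le_of_mem_closedBall (OnlineNN.outOp d m L)
      (OnlineNN.norm_readout_le _) hθ hθ₀.2
    obtain ⟨h1, h2⟩ := hnet hd hm1 θ (1 + ρ) (by linarith) (fun l => by linarith [hh l]) ho x hx
    constructor
    · refine ((OnlineNN.twiceDifferentiable_net hφ x).norm_fderiv_gradient_le θ).trans
        (h2.trans ?_)
      rw [div_right_comm]
      gcongr
      linarith
    · refine (OnlineNN.norm_gradient_le _ θ).trans (h1.trans ?_)
      -- Since `1` and `ρ` are both at most `√m`, the gradient bound is free of `ρ`.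
      have : (1 + ρ) * β / √(m : ℝ) ≤ 2 * β := by
        rw [div_le_iff₀ hs0]
        calc (1 + ρ) * β ≤ (√(m : ℝ) + √(m : ℝ)) * β := by gcongr
          _ = _ := by ring
      linarith
  refine ⟨fun θ hθ x hx => ⟨(hbound θ hθ x hx).1.trans (half_le_self (by positivity)),
    (hbound θ hθ x hx).2⟩, fun n hn x hx y ℓ lam a hlam ha hℓ θt ht θ' h' θ'' h'' => ?_⟩
  have := OnlineNN.batchLoss_almost_convex hφ hn ha
    (h := (2 * ((1 + ρ) * γ + 2 * β) + 1) / √(m : ℝ)) (by positivity)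
    (fun i θ hθ => (hbound θ hθ (x i) (hx i)).2) (fun i θ hθ => (hbound θ hθ (x i) (hx i)).1)
    hℓ ht h' h''
  refine le_trans (le_of_eq ?_) this
  ring
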